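/- Equip $C^2[0,1]$ with the norm $\|u\|_2=\max\{\|u\|_\infty,\|u'\|_\infty,\|u''\|_\infty\}$, and for $\rho\in(0,\infty)$ let $\overline B_\rho$ and $\partial B_\rho$ be the closed ball and the sphere of radius $\rho$ centred at $0$ in this space. Put $\Pi_\rho=[0,1]\times[-\rho,\rho]^3$, $\gamma_1(t)=1-4t+3t^2$, $\gamma_2(t)=-2t+3t^2$ and $$k(t,s)=\frac12\begin{cases}s^2(1-t)(3t-2ts-1),&0\le s\le t\le1,\\ t(1-s)^2(2ts+t-2s),&0\le t\le s\le1.\end{cases}$$ Given functions $f:\Pi_\rho\to\mathbb R$ and $H_1,H_2:\overline B_\rho\to\mathbb R$, we say that $\lambda\in\mathbb R$ is an eigenvalue with eigenfunction $u\in\overline B_\rho$ of the boundary value problem $$u'''+\lambda f(t,u,u',u'')=0\ \text{on }(0,1),\qquad u(0)=\lambda H_1[u],\quad u(1)=\lambda H_2[u],\quad \int_0^1u(t)\,dt=0,$$ if $\|u\|_2>0$ and $(u,\lambda)$ satisfies the associated perturbed Hammerstein equation $$u(t)=\lambda\Bigl(\gamma_1(t)H_1[u]+\gamma_2(t)H_2[u]+\int_0^1k(t,s)f(s,u(s),u'(s),u''(s))\,ds\Bigr),\qquad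 t\in[0,1].$$ **Theorem.** Let $\rho\in(0,\infty)$, let $f:\Pi_\rho\to\mathbb R$ be continuous and let $\delta:[0,1]\to[0,\infty)$ be continuous. Let $H_1,H_2:\overline B_\rho\to\mathbb R$ be continuous and bounded, and let $\eta_1,\eta_2\in\mathbb R$ be such that $H_i[u]\ge\eta_i$ for every $u\in\partial B_\rho$ and $i\in\{1,2\}$. Suppose that at least one of the following holds: (a) $f(t,u,v,w)\ge\delta(t)$ for all $(t,u,v,w)\in\Pi_\rho$, and $6(\eta_1+\eta_2)+\int_0^1(1-s)^2(2s+1)\delta(s)\,ds>0$; (b) $-f(t,u,v,w)\ge\delta(t)$ for all $(t,u,v,w)\in\Pi_\rho$, and $6(\eta_1+\eta_2)+\int_0^1s^2(3-2s)\delta(s)\,ds>0$. Then the boundary value problem has a positive eigenvalue $\lambda_\rho^+$ with an eigenfunction $u_\rho^+\in\partial B_\rho$, and a negative eigenvalue $\lambda_\rho^-$ with an eigenfunction $u_\rho^-\in\partial B_\rho$. -/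

import Mathlib

open Set

noncomputable section

/-- The real vector space of twice continuously differentiable functions on `[0,1]`
(one-sided derivatives at the endpoints), inside the continuous functions on `[0,1]`.
`IccExtend` extends a function on `[0,1]` to `ℝ` by constants; only its restriction to `[0,1]`
matters here. -/
def C2Submodule : Submodule ℝ C(Icc (0 : ℝ) 1, ℝ) where
  carrier := {u | ContDiffOn ℝ 2 (IccExtend zero_le_one (u : Icc (0 : ℝ) 1 → ℝ)) (Icc 0 1)}
  zero_mem' := contDiffOn_const (c := (0 : ℝ))
  add_mem' := fun hu hv => ContDiffOn.add hu hv
  smul_mem' := fun c _ hu => ContDiffOn.const_smul c hu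

/-- The space `C²[0,1]`. It is a separate type, because its norm is not the one inherited from
`C[0,1]`. -/
def C2 : Type := C2Submodule

namespace C2

instance : AddCommGroup C2 := inferInstanceAs (AddCommGroup C2Submodule)

instance : Module ℝ C2 := inferInstanceAs (Module ℝ C2Submodule)

/-- The function underlying an element of `C²[0,1]`, as a function of a real variable that is
to be evaluated on `[0,1]`. -/
def fn (u : C2) : ℝ → ℝ := IccExtend zero_le_one (u.1 : Icc (0 : ℝ) 1 → ℝ)

theorem contDiffOn_fn (u : C2) : ContDiffOn ℝ 2 u.fn (Icc 0 1) := u.2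

/-- The `j`-th derivative of `u` on `[0,1]`, one-sided at the endpoints. -/
def D (j : ℕ) (u : C2) : ℝ → ℝ := iteratedDerivWithin j u.fn (Icc 0 1)

theorem continuousOn_D {j : ℕ} (hj : j ≤ 2) (u : C2) : ContinuousOn (D j u) (Icc 0 1) :=
  u.contDiffOn_fn.continuousOn_iteratedDerivWithin (by exact_mod_cast hj)
    (uniqueDiffOn_Icc zero_lt_one)

theorem D_add {j : ℕ} (hj : j ≤ 2) (u v : C2) {t : ℝ} (ht : t ∈ Icc (0 : ℝ) 1) :
    D j (u + v) t = D j u t + D j v t :=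
  iteratedDerivWithin_add ht (uniqueDiffOn_Icc zero_lt_one)
    ((u.contDiffOn_fn.of_le (by exact_mod_cast hj)) t ht)
    ((v.contDiffOn_fn.of_le (by exact_mod_cast hj)) t ht)

theorem D_smul {j : ℕ} (hj : j ≤ 2) (c : ℝ) (u : C2) {t : ℝ} (ht : t ∈ Icc (0 : ℝ) 1) :
    D j (c • u) t = c * D j u t :=
  iteratedDerivWithin_const_smul ht (uniqueDiffOn_Icc zero_lt_one) c
    ((u.contDiffOn_fn.of_le (by exact_mod_cast hj)) t ht)

/-- The `j`-th derivative (`j ≤ 2`) as a linear map from `C²[0,1]` to `C[0,1]`. -/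
def derivMap (j : ℕ) (hj : j ≤ 2) : C2 →ₗ[ℝ] C(Icc (0 : ℝ) 1, ℝ) where
  toFun u := ⟨fun t => D j u t, (continuousOn_D hj u).domRestrict⟩
  map_add' u v := by ext t; exact D_add hj u v t.2
  map_smul' c u := by ext t; exact D_smul hj c u t.2

/-- The map `u ↦ (u, u', u'')`. -/
def jet : C2 →ₗ[ℝ] C(Icc (0 : ℝ) 1, ℝ) × C(Icc (0 : ℝ) 1, ℝ) × C(Icc (0 : ℝ) 1, ℝ) :=
  (derivMap 0 (by norm_num)).prod ((derivMap 1 (by norm_num)).prod (derivMap 2 le_rfl))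

theorem derivMap_zero (u : C2) : derivMap 0 (by norm_num) u = u.1 := by
  ext t
  simp [derivMap, D, fn]

theorem jet_injective : Function.Injective jet := by
  intro u v h
  have h0 : derivMap 0 (by norm_num) u = derivMap 0 (by norm_num) v := congrArg Prod.fst h
  rw [derivMap_zero, derivMap_zero] at h0
  exact Subtype.ext h0

/-- The norm `‖u‖₂ = max (‖u‖_∞, ‖u'‖_∞, ‖u''‖_∞)`, see `C2.norm_eq`. -/
instance : NormedAddCommGroup C2 := NormedAddCommGroup.induced C2 _ jet jet_injective

instance : NormedSpace ℝ C2 := NormedSpace.induced ℝ C2 _ jet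

theorem norm_eq (u : C2) :
    ‖u‖ = max ‖derivMap 0 (by norm_num) u‖
      (max ‖derivMap 1 (by norm_num) u‖ ‖derivMap 2 le_rfl u‖) := rfl

end C2

/-- The Green's function of `-u''' = h`, `u(0) = u(1) = ∫₀¹ u = 0`. -/
def greenK (t s : ℝ) : ℝ :=
  if s ≤ t then s ^ 2 * (1 - t) * (3 * t - 2 * t * s - 1) / 2
  else t * (1 - s) ^ 2 * (2 * t * s + t - 2 * s) / 2

def gamma1 (t : ℝ) : ℝ := 1 - 4 * t + 3 * t ^ 2

def gamma2 (t : ℝ) : ℝ := -2 * t + 3 * t ^ 2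

/-- `lam` is an eigenvalue with corresponding eigenfunction `u` of the boundary value problem
`u''' + lam f(t,u,u',u'') = 0`, `u(0) = lam H₁[u]`, `u(1) = lam H₂[u]`, `∫₀¹ u = 0`: the function
`u` is nonzero and the pair satisfies the associated perturbed Hammerstein equation. -/
def IsEigenpair (f : ℝ → ℝ → ℝ → ℝ → ℝ) (H₁ H₂ : C2 → ℝ) (lam : ℝ) (u : C2) : Prop :=
  0 < ‖u‖ ∧ ∀ t ∈ Icc (0 : ℝ) 1,
    u.fn t = lam * (gamma1 t * H₁ u + gamma2 t * H₂ u
      + ∫ s in (0 : ℝ)..1, greenK t s * f s (u.fn s) (C2.D 1 u s) (C2.D 2 u s))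

end

/-! Write the equation as `u = λ T u`. The argument is of Birkhoff–Kellogg type, with a half-space
in place of a cone. Differentiating the Hammerstein operator twice gives (T u)''(0) = 6 (H₁[u] +
H₂[u]) + ∫ (1-s)² (2s+1) f and (T u)''(1) = 6 (H₁[u] + H₂[u]) - ∫ s² (3-2s) f. Hypothesis (a) bounds
the first number below by some c > 0 on the sphere, hypothesis (b) the second. Hence, for φ(v) =
v''(0) or φ(v) = v''(1), `T` maps the sphere into the convex set C = {φ ≥ c}, which misses 0. For
either sign, P(v) = ± ρ v / ‖v‖ sends C continuously to the sphere, and T ∘ P is a compact self-map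
of C. A Schauder fixed point v yields u = P(v) with u = ± (ρ / ‖v‖) T u, hence eigenvalues of both
signs (`exists_mem_sphere_eq_smul_of_compact`).

Schauder's theorem is reduced to Brouwer's by projecting onto finite-dimensional simplices.
Brouwer's theorem follows from the absence of a C¹ retraction r of a ball onto its sphere: the
integral of det(1 + t (Dr - 1)) over the ball is a polynomial in t, equal to the volume for small t
≥ 0 by change of variables, yet zero at t = 1 because Dr is singular.

Compactness of `T` comes from factoring it through bounded real data and the primitive of a bounded
function (`C2.exists_hammerstein_operator`). -/

noncomputable section

/-! ### Determinants of perturbations of the identity -/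

/-- The determinant of `1 + A` is a fixed affine combination of the determinants of `1 + t • A`,
where `t` runs through more than `dim E` nodes. -/
theorem exists_det_one_add_eq_sum {E : Type*} [AddCommGroup E] [Module ℝ E]
    [FiniteDimensional ℝ E] (s : Finset ℝ) (hs : Module.finrank ℝ E < s.card) :
    ∃ c : ℝ → ℝ, ∑ t ∈ s, c t = 1 ∧
      ∀ A : E →ₗ[ℝ] E, LinearMap.det (1 + A) = ∑ t ∈ s, c t * LinearMap.det (1 + t • A) := by
  have hinj : Set.InjOn (id : ℝ → ℝ) s := Function.injective_id.injOn
  have hne : s.Nonempty := Finset.card_pos.mp (by omega)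
  -- The weights are the Lagrange basis polynomials of the nodes, evaluated at 1; they sum to 1
  -- because constants are interpolated exactly.
  refine ⟨fun t => (Lagrange.basis s id t).eval 1, ?_, fun A => ?_⟩
  · rw [← Polynomial.eval_finsetSum, Lagrange.sum_basis hinj hne, Polynomial.eval_one]
  · let b := Module.finBasis ℝ E
    let M := LinearMap.toMatrix b b A
    -- det(1 + t A) is a polynomial in t, the reversed characteristic polynomial of -A, so its
    -- degree is at most dim E.
    have hev : ∀ t : ℝ, (-M).charpolyRev.eval t = LinearMap.det (1 + t • A) := by
      intro t
      rw [← LinearMap.det_toMatrix b, Matrix.charpolyRev, ← Polynomial.coe_evalRingHom,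
        RingHom.map_det]
      congr 1
      ext i j
      rcases eq_or_ne i j with hij | hij <;>
        simp [hij, M, LinearMap.toMatrix_one, sub_eq_add_neg, mul_comm t]
    have hdeg : (-M).charpolyRev.degree < s.card := by
      refine lt_of_le_of_lt Polynomial.degree_le_natDegree ?_
      rw [← Matrix.reverse_charpoly]
      refine lt_of_le_of_lt (Nat.cast_le.mpr (Polynomial.reverse_natDegree_le _)) ?_
      rw [Matrix.charpoly_natDegree_eq_dim]
      simpa using hs
    have h1 := congrArg (Polynomial.eval 1) (Lagrange.eq_interpolate hinj hdeg)
    rw [hev, one_smul, Lagrange.interpolate_apply, Polynomial.eval_finsetSum] at h1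
    rw [h1]
    refine Finset.sum_congr rfl fun t _ => ?_
    rw [Polynomial.eval_mul, Polynomial.eval_C, id, hev, mul_comm]

/-- If `A` is a small perturbation, then `1 + A` has positive determinant. -/
theorem det_one_add_pos {E : Type*} [NormedAddCommGroup E] [NormedSpace ℝ E]
    [FiniteDimensional ℝ E] (A : E →L[ℝ] E) (hA : ‖A‖ < 1) : 0 < (1 + A).det := by
  have hne : ∀ t ∈ Icc (0 : ℝ) 1, (1 + t • A).det ≠ 0 := by
    intro t ht h0
    obtain ⟨v, hv, hv0⟩ := (Submodule.ne_bot_iff _).mp (LinearMap.det_eq_zero_iff_ker_ne_bot.mp h0)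
    have hv' : v = -(t • A v) := by
      have : v + t • A v = 0 := by simpa using hv
      exact eq_neg_of_add_eq_zero_left this
    have h1 : ‖v‖ ≤ ‖A‖ * ‖v‖ := by
      calc ‖v‖ = ‖t • A v‖ := by conv_lhs => rw [hv', norm_neg]
        _ = |t| * ‖A v‖ := norm_smul _ _
        _ ≤ 1 * (‖A‖ * ‖v‖) := by
          gcongr
          · rw [abs_of_nonneg ht.1]; exact ht.2
          · exact A.le_opNorm v
        _ = ‖A‖ * ‖v‖ := one_mul _
    have : 0 < ‖v‖ := norm_pos_iff.mpr hv0
    nlinarith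
  -- The determinant is 1 at t = 0 and never vanishes on [0,1], so it cannot change sign.
  by_contra! hle
  have hc : ContinuousOn (fun t : ℝ => (1 + t • A).det) (Icc 0 1) :=
    (ContinuousLinearMap.continuous_det.comp (by fun_prop)).continuousOn
  obtain ⟨t, ht, h0⟩ := intermediate_value_Icc' zero_le_one hc
    (show (0 : ℝ) ∈ Icc _ _ by simpa [ContinuousLinearMap.det] using hle)
  exact hne t ht h0

/-! ### No C¹ retraction of a ball onto its sphere -/

section Retraction

variable {E : Type*} [NormedAddCommGroup E] [NormedSpace ℝ E]

/-- A map which is Lipschitz on a ball and vanishes on the bounding sphere stays Lipschitz with the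
same constant when it is extended by zero. -/
theorem lipschitzWith_indicator_closedBall {F : Type*} [NormedAddCommGroup F]
    {R : ℝ} {K : NNReal} {g : E → F}
    (hg : LipschitzOnWith K g (Metric.closedBall 0 R)) (h0 : ∀ x ∈ Metric.sphere 0 R, g x = 0) :
    LipschitzWith K ((Metric.closedBall (0 : E) R).indicator g) := by
  have key : ∀ x ∈ Metric.closedBall (0 : E) R, ∀ y ∉ Metric.closedBall (0 : E) R,
      dist (g x) 0 ≤ K * dist x y := by
    intro x hx y hy
    rw [mem_closedBall_zero_iff] at hx hy
    push Not at hy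
    -- The segment from x to y crosses the sphere at a point z where g vanishes, and z is no farther
    -- from x than y is.
    have hc : ContinuousOn (fun t : ℝ => ‖AffineMap.lineMap x y t‖) (Icc 0 1) := by
      have : Continuous (fun t : ℝ => ‖AffineMap.lineMap x y t‖) :=
        AffineMap.lineMap_continuous.norm
      exact this.continuousOn
    obtain ⟨t, ht, htR⟩ := intermediate_value_Icc zero_le_one hc
      (show R ∈ Icc _ _ by simpa using ⟨hx, hy.le⟩)
    set z := AffineMap.lineMap x y t with hz
    have hzR : z ∈ Metric.sphere (0 : E) R := by simpa using htR
    calc dist (g x) 0 = dist (g x) (g z) := by rw [h0 z hzR]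
      _ ≤ K * dist x z := hg.dist_le_mul x (by simpa using hx) z
          (Metric.sphere_subset_closedBall hzR)
      _ ≤ K * dist x y := by
        gcongr
        rw [hz, dist_left_lineMap, Real.norm_of_nonneg ht.1]
        exact mul_le_of_le_one_left dist_nonneg ht.2
  refine LipschitzWith.of_dist_le_mul fun x y => ?_
  by_cases hx : x ∈ Metric.closedBall (0 : E) R <;> by_cases hy : y ∈ Metric.closedBall (0 : E) R
  · rw [indicator_of_mem hx, indicator_of_mem hy]; exact hg.dist_le_mul x hx y hy
  · rw [indicator_of_mem hx, indicator_of_notMem hy]; exact key x hx y hy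
  · rw [indicator_of_notMem hx, indicator_of_mem hy, dist_comm, dist_comm x]; exact key y hy x hx
  · rw [indicator_of_notMem hx, indicator_of_notMem hy, dist_self]; positivity

/-- A small Lipschitz perturbation of the identity of a ball which fixes the sphere is surjective. -/
theorem surjOn_add_smul_closedBall [CompleteSpace E] {R : ℝ} {K : NNReal} {g : E → E}
    (hg : LipschitzOnWith K g (Metric.closedBall 0 R)) (h0 : ∀ x ∈ Metric.sphere 0 R, g x = 0)
    {t : ℝ} (ht : 0 ≤ t) (htK : t * K < 1) :
    SurjOn (fun x => x + t • g x) (Metric.closedBall 0 R) (Metric.closedBall 0 R) := by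
  intro y hy
  set G := (Metric.closedBall (0 : E) R).indicator g
  have hG := lipschitzWith_indicator_closedBall hg h0
  -- Solutions of x + t G(x) = y are the fixed points of this contraction. A fixed point outside the
  -- ball would equal y, which lies inside.
  have hcontr : ContractingWith (t.toNNReal * K) (fun x => y - t • G x) := by
    refine ⟨?_, LipschitzWith.of_dist_le_mul fun x z => ?_⟩
    · rw [← NNReal.coe_lt_coe]; simpa [ht] using htK
    · rw [dist_sub_left, dist_smul₀, Real.norm_of_nonneg ht, NNReal.coe_mul,
        Real.coe_toNNReal _ ht, mul_assoc]
      gcongr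
      exact hG.dist_le_mul x z
  have hfix : y - t • G (hcontr.fixedPoint _) = hcontr.fixedPoint _ := hcontr.fixedPoint_isFixedPt
  set x := hcontr.fixedPoint _
  have hxy : x + t • G x = y := (sub_eq_iff_eq_add.mp hfix).symm
  have hx : x ∈ Metric.closedBall (0 : E) R := by
    by_contra hx
    have hGx : G x = 0 := indicator_of_notMem hx g
    rw [hGx, smul_zero, add_zero] at hxy
    exact hx (hxy ▸ hy)
  refine ⟨x, hx, ?_⟩
  have hGx : G x = g x := indicator_of_mem hx g
  simpa [hGx] using hxy

end Retraction

open MeasureTheory in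
/-- A self-map of a ball whose difference to the identity is `C¹` and vanishes on the sphere has a
Jacobian determinant that integrates to the volume of the ball, as long as it is close to the
identity. -/
theorem integral_det_one_add_smul_fderiv {E : Type*} [NormedAddCommGroup E] [NormedSpace ℝ E]
    [FiniteDimensional ℝ E] [MeasurableSpace E] [BorelSpace E] (μ : Measure E)
    [μ.IsAddHaarMeasure] {R : ℝ} {K : NNReal} {g : E → E} {g' : E → E →L[ℝ] E}
    (hg : ∀ x ∈ Metric.closedBall 0 R, HasFDerivWithinAt g (g' x) (Metric.closedBall 0 R) x)
    (hK : ∀ x ∈ Metric.closedBall 0 R, ‖g' x‖ ≤ K) (h0 : ∀ x ∈ Metric.sphere 0 R, g x = 0)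
    {t : ℝ} (ht : 0 ≤ t) (htK : t * K < 1)
    (hmaps : MapsTo (fun x => x + t • g x) (Metric.closedBall 0 R) (Metric.closedBall 0 R)) :
    ∫ x in Metric.closedBall 0 R, (1 + t • g' x).det ∂μ = μ.real (Metric.closedBall 0 R) := by
  have : CompleteSpace E := FiniteDimensional.complete ℝ E
  have hlip : LipschitzOnWith K g (Metric.closedBall 0 R) :=
    (convex_closedBall 0 R).lipschitzOnWith_of_nnnorm_hasFDerivWithin_le hg hK
  have hinj : InjOn (fun x => x + t • g x) (Metric.closedBall 0 R) := by
    intro x hx y hy hxy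
    have h1 : x - y = t • (g y - g x) := by
      rw [smul_sub, sub_eq_sub_iff_add_eq_add]
      simpa [add_comm] using hxy
    have h2 : ‖x - y‖ ≤ (t * K) * ‖x - y‖ := by
      calc ‖x - y‖ = t * dist (g x) (g y) := by
            rw [h1, norm_smul, Real.norm_of_nonneg ht, dist_comm, dist_eq_norm]
        _ ≤ t * (K * dist x y) := by gcongr; exact hlip.dist_le_mul x hx y hy
        _ = (t * K) * ‖x - y‖ := by rw [dist_eq_norm, mul_assoc]
    by_contra hne
    have : 0 < ‖x - y‖ := norm_pos_iff.mpr (sub_ne_zero.mpr hne)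
    nlinarith
  have himage : (fun x => x + t • g x) '' Metric.closedBall 0 R = Metric.closedBall 0 R :=
    (surjOn_add_smul_closedBall hlip h0 ht htK).image_eq_of_mapsTo hmaps
  have hderiv : ∀ x ∈ Metric.closedBall 0 R,
      HasFDerivWithinAt (fun x => x + t • g x) (1 + t • g' x) (Metric.closedBall 0 R) x :=
    fun x hx => (hasFDerivWithinAt_id x _).add ((hg x hx).const_smul t)
  have h := integral_image_eq_integral_abs_det_fderiv_smul μ measurableSet_closedBall hderiv hinj
    (fun _ => (1 : ℝ))
  rw [himage] at h
  rw [setIntegral_const, smul_eq_mul, mul_one] at h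
  rw [h]
  refine setIntegral_congr_fun measurableSet_closedBall fun x hx => ?_
  have hpos : 0 < (1 + t • g' x).det := by
    refine det_one_add_pos _ (lt_of_le_of_lt ?_ htK)
    rw [norm_smul, Real.norm_of_nonneg ht]
    gcongr
    exact hK x hx
  simp [abs_of_pos hpos]

open MeasureTheory in
/-- There is no `C¹` retraction of a ball onto its boundary sphere. -/
theorem not_contDiffOn_retraction_sphere {E : Type*} [NormedAddCommGroup E]
    [InnerProductSpace ℝ E] [FiniteDimensional ℝ E] {R : ℝ} (hR : 0 < R) {U : Set E}
    (hU : IsOpen U) (hball : Metric.closedBall 0 R ⊆ U) {r : E → E} (hr : ContDiffOn ℝ 1 r U)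
    (hnorm : ∀ x ∈ U, ‖r x‖ = R) : ¬ ∀ x ∈ Metric.sphere 0 R, r x = x := by
  intro hid
  borelize E
  set B := Metric.closedBall (0 : E) R
  have hBc : IsCompact B := isCompact_closedBall 0 R
  have hr' : ∀ x ∈ B, HasFDerivAt r (fderiv ℝ r x) x := fun x hx =>
    ((hr.differentiableOn one_ne_zero).differentiableAt (hU.mem_nhds (hball hx))).hasFDerivAt
  have hcont : ContinuousOn (fderiv ℝ r) B :=
    (hr.continuousOn_fderiv_of_isOpen hU le_rfl).mono hball
  set g : E → E := fun x => r x - x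
  set g' : E → E →L[ℝ] E := fun x => fderiv ℝ r x - 1
  have hg : ∀ x ∈ B, HasFDerivWithinAt g (g' x) B x := fun x hx =>
    ((hr' x hx).sub (hasFDerivAt_id x)).hasFDerivWithinAt
  have hg'c : ContinuousOn g' B := hcont.sub continuousOn_const
  obtain ⟨C, hC⟩ := hBc.exists_bound_of_continuousOn hg'c
  set K : NNReal := C.toNNReal
  have hK : ∀ x ∈ B, ‖g' x‖ ≤ K := fun x hx => (hC x hx).trans (Real.le_coe_toNNReal C)
  have h0 : ∀ x ∈ Metric.sphere 0 R, g x = 0 := fun x hx => sub_eq_zero.mpr (hid x hx)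
  have hmaps : ∀ t ∈ Icc (0 : ℝ) 1, MapsTo (fun x => x + t • g x) B B := by
    intro t ht x hx
    exact (convex_closedBall (0 : E) R).add_smul_sub_mem hx
      (by simpa using (hnorm x (hball hx)).le) ht
  -- For t in [0, ε] this gives both t K < 1, as the change of variables needs, and t ≤ 1, so that
  -- the ball is mapped to itself by convexity.
  set ε : ℝ := 1 / (K + 1)
  have hε : 0 < ε := by positivity
  have hε1 : ε * (K + 1) = 1 := by simp only [ε]; field_simp
  obtain ⟨s, hs, hcard⟩ := (Icc_infinite (α := ℝ) hε).exists_subset_card_eq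
    (Module.finrank ℝ E + 1)
  obtain ⟨c, hc1, hc⟩ := exists_det_one_add_eq_sum (E := E) s (by omega)
  have hnode : ∀ t ∈ s, ∫ x in B, (1 + t • g' x).det = volume.real B := by
    intro t ht
    obtain ⟨ht0, htε⟩ := hs ht
    have hKn : (0 : ℝ) ≤ K := K.2
    exact integral_det_one_add_smul_fderiv volume hg hK h0 ht0 (by nlinarith)
      (hmaps t ⟨ht0, by nlinarith⟩)
  have hint : ∀ t : ℝ, IntegrableOn (fun x => (1 + t • g' x).det) B := fun t =>
    (ContinuousLinearMap.continuous_det.comp_continuousOn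
      (continuousOn_const.add (hg'c.const_smul t))).integrableOn_compact hBc
  -- Being constant at dim E + 1 nodes near 0, the polynomial t ↦ ∫ det(1 + t g') takes the same
  -- value at t = 1.
  have htotal : ∫ x in B, (1 + g' x).det = volume.real B := by
    have : ∀ x, (1 + g' x).det = ∑ t ∈ s, c t * (1 + t • g' x).det := fun x => hc (g' x)
    simp_rw [this]
    rw [integral_finsetSum _ fun t _ => (hint t).const_mul (c t)]
    simp_rw [integral_const_mul]
    rw [Finset.sum_congr rfl fun t ht => by rw [hnode t ht], ← Finset.sum_mul, hc1, one_mul]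
  -- ‖r‖² is constant near x, so r(x) is orthogonal to the range of Dr(x). A surjective Dr(x) would
  -- have r(x) ≠ 0 in its range.
  have hzero : ∀ x ∈ B, (1 + g' x).det = 0 := by
    intro x hx
    rw [show 1 + g' x = fderiv ℝ r x by simp [g']]
    by_contra hdet
    have hsurj : Function.Surjective (fderiv ℝ r x) := by
      have hu : IsUnit (LinearMap.det (fderiv ℝ r x : E →ₗ[ℝ] E)) := isUnit_iff_ne_zero.mpr hdet
      exact ((Module.End.isUnit_iff _).mp ((LinearMap.isUnit_iff_isUnit_det _).mpr hu)).2
    obtain ⟨v, hv⟩ := hsurj (r x)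
    have hd : HasFDerivAt (fun y => ‖r y‖ ^ 2)
        (2 • (innerSL ℝ (r x)).comp (fderiv ℝ r x)) x := (hr' x hx).norm_sq
    have hd0 : HasFDerivAt (fun y => ‖r y‖ ^ 2) (0 : E →L[ℝ] ℝ) x := by
      refine (hasFDerivAt_const (R ^ 2) x).congr_of_eventuallyEq ?_
      filter_upwards [hU.mem_nhds (hball hx)] with y hy
      rw [hnorm y hy]
    have h1 := DFunLike.congr_fun (hd.unique hd0) v
    have h2 : ‖r x‖ = R := hnorm x (hball hx)
    simp [hv, h2, hR.ne'] at h1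
  rw [setIntegral_congr_fun measurableSet_closedBall hzero, integral_zero] at htotal
  have hpos : 0 < volume.real B :=
    ENNReal.toReal_pos (Metric.measure_closedBall_pos volume 0 hR).ne' hBc.measure_lt_top.ne
  exact hpos.ne htotal

/-! ### Brouwer's fixed point theorem -/

section Brouwer

variable {E : Type*} [NormedAddCommGroup E] [InnerProductSpace ℝ E] [FiniteDimensional ℝ E]

open RealInnerProductSpace in
/-- Brouwer's fixed point theorem for `C¹` maps into an open ball. -/
theorem ContDiff.exists_eq_self_of_norm_lt {p : E → E} (hp : ContDiff ℝ 1 p) {R : ℝ}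
    (hR : ∀ x, ‖p x‖ < R) : ∃ x, p x = x := by
  by_contra! hne
  have hR0 : 0 < R := (norm_nonneg _).trans_lt (hR 0)
  set u : E → E := fun x => x - p x
  have hu : ContDiff ℝ 1 u := contDiff_id.sub hp
  have hu0 : ∀ x, 0 < ‖u x‖ := fun x => norm_pos_iff.mpr (sub_ne_zero.mpr (hne x).symm)
  -- The retraction sends x to the point where the ray from p(x) through x leaves the sphere. `D` is
  -- the reduced discriminant of ‖x + s u(x)‖² = R² as a quadratic in s, and the larger root is
  -- taken; it is 0 on the sphere, where ⟪x, u x⟫ > 0.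
  set D : E → ℝ := fun x => ⟪x, u x⟫ ^ 2 + ‖u x‖ ^ 2 * (R ^ 2 - ‖x‖ ^ 2)
  have hb : ContDiff ℝ 1 fun x => ⟪x, u x⟫ := contDiff_id.inner ℝ hu
  have hD : ContDiff ℝ 1 D := (hb.pow 2).add
    ((hu.norm_sq ℝ).mul (contDiff_const.sub (contDiff_id.norm_sq ℝ)))
  have hsphere : ∀ x : E, ‖x‖ = R → 0 < ⟪x, u x⟫ := by
    intro x hx
    have h1 : ⟪x, p x⟫ ≤ ‖x‖ * ‖p x‖ := real_inner_le_norm x (p x)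
    have h2 : ⟪x, u x⟫ = R ^ 2 - ⟪x, p x⟫ := by
      simp only [u]
      rw [inner_sub_right, real_inner_self_eq_norm_sq, hx]
    have := hR x
    rw [hx] at h1
    nlinarith
  set s : E → ℝ := fun x => (-⟪x, u x⟫ + √(D x)) / ‖u x‖ ^ 2
  set U : Set E := {x | 0 < D x}
  have hs : ContDiffOn ℝ 1 s U :=
    (hb.neg.contDiffOn.add (hD.contDiffOn.sqrt fun x hx => (show 0 < D x from hx).ne')).div
      (hu.norm_sq ℝ).contDiffOn fun x _ => (pow_pos (hu0 x) 2).ne'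
  have hball : Metric.closedBall 0 R ⊆ U := by
    intro x hx
    rw [mem_closedBall_zero_iff] at hx
    rcases hx.lt_or_eq with hlt | heq
    · have h1 : 0 < R ^ 2 - ‖x‖ ^ 2 := by nlinarith [norm_nonneg x]
      have h2 := mul_pos (pow_pos (hu0 x) 2) h1
      exact add_pos_of_nonneg_of_pos (sq_nonneg _) h2
    · have h1 := hsphere x heq
      change 0 < ⟪x, u x⟫ ^ 2 + ‖u x‖ ^ 2 * (R ^ 2 - ‖x‖ ^ 2)
      rw [heq]
      nlinarith
  refine not_contDiffOn_retraction_sphere (r := fun x => x + s x • u x) hR0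
    (isOpen_lt continuous_const hD.continuous) hball
    (contDiff_id.contDiffOn.add (hs.smul hu.contDiffOn)) ?_ ?_
  · intro x hx
    have hsq : ‖x + s x • u x‖ ^ 2 = R ^ 2 := by
      have hD2 : √(D x) ^ 2 = D x := Real.sq_sqrt (le_of_lt hx)
      have hne := (hu0 x).ne'
      rw [norm_add_sq_real, inner_smul_right, norm_smul, mul_pow, Real.norm_eq_abs, sq_abs]
      simp only [s]
      field_simp
      simp only [D] at hD2 ⊢
      linear_combination hD2
    exact (pow_left_inj₀ (norm_nonneg _) hR0.le two_ne_zero).mp hsq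
  · intro x hx
    have hx' : ‖x‖ = R := by simpa using hx
    have h1 : D x = ⟪x, u x⟫ ^ 2 := by simp [D, hx']
    simp [s, h1, Real.sqrt_sq (hsphere x hx').le]

/-- **Brouwer's fixed point theorem** for bounded continuous maps of a Euclidean space. -/
theorem Continuous.exists_eq_self_of_norm_le {f : E → E} (hf : Continuous f) {R : ℝ}
    (hR : ∀ x, ‖f x‖ ≤ R) : ∃ x, f x = x := by
  have hR0 : 0 ≤ R := (norm_nonneg _).trans (hR 0)
  have hcomp : IsCompact (Metric.closedBall (0 : E) (R + 1)) := isCompact_closedBall 0 _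
  obtain ⟨x, -, hx⟩ := hcomp.exists_isMinOn ⟨0, by simp; linarith⟩
    (f := fun x => ‖f x - x‖) (by fun_prop)
  refine ⟨x, ?_⟩
  by_contra hne
  -- The bound by the minimal displacement makes the fixed point of the approximation contradictory;
  -- the bound by 1 keeps that fixed point in the ball of radius R + 1.
  set ε := min (‖f x - x‖) 1
  have hε : 0 < ε := lt_min (norm_pos_iff.mpr (sub_ne_zero.mpr hne)) one_pos
  obtain ⟨p, hp, hpf, -⟩ := hf.exists_contDiff_approx 1 (ε := fun _ => ε) continuous_const
    fun _ => hε
  have hpR : ∀ y, ‖p y‖ < R + 1 := fun y => by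
    calc ‖p y‖ ≤ ‖f y‖ + ‖p y - f y‖ := by
          simpa using norm_add_le (f y) (p y - f y)
      _ < R + 1 := add_lt_add_of_le_of_lt (hR y)
          ((dist_eq_norm (p y) (f y) ▸ hpf y).trans_le (min_le_right _ _))
  obtain ⟨y, hy⟩ := ContDiff.exists_eq_self_of_norm_lt (by exact_mod_cast hp) hpR
  have hyb : y ∈ Metric.closedBall (0 : E) (R + 1) := by
    rw [mem_closedBall_zero_iff, ← hy]; exact (hpR y).le
  have h1 : ‖f x - x‖ ≤ ‖f y - y‖ := hx hyb
  have h2 : ‖f y - y‖ < ε := by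
    have := hpf y
    rwa [dist_comm, dist_eq_norm, hy] at this
  exact absurd (h1.trans_lt (h2.trans_le (min_le_left _ _))) (lt_irrefl _)

end Brouwer

/-! ### Schauder's theorem and eigenvectors of compact maps -/

section Schauder

/-- A retraction of `ℝ^ι` onto the standard simplex. -/
def simplexRetraction {ι : Type*} [Fintype ι] (w : EuclideanSpace ℝ ι) (i : ι) : ℝ :=
  (max (w i) 0 + max (1 - ∑ j, max (w j) 0) 0 / Fintype.card ι) / max 1 (∑ j, max (w j) 0)

theorem continuous_simplexRetraction {ι : Type*} [Fintype ι] (i : ι) :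
    Continuous fun w : EuclideanSpace ℝ ι => simplexRetraction w i := by
  unfold simplexRetraction
  refine Continuous.div (by fun_prop) (by fun_prop) fun w => ?_
  exact (lt_max_of_lt_left one_pos).ne'

theorem simplexRetraction_nonneg {ι : Type*} [Fintype ι] (w : EuclideanSpace ℝ ι) (i : ι) :
    0 ≤ simplexRetraction w i := by
  unfold simplexRetraction
  positivity

/-- If the positive parts sum to at most 1, the missing mass is spread evenly; otherwise they are
divided by their sum. -/
theorem sum_simplexRetraction {ι : Type*} [Fintype ι] [Nonempty ι] (w : EuclideanSpace ℝ ι) :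
    ∑ i, simplexRetraction w i = 1 := by
  unfold simplexRetraction
  have h0 : (0 : ℝ) < max 1 (∑ j, max (w j) 0) := lt_max_of_lt_left one_pos
  rw [← Finset.sum_div, Finset.sum_add_distrib, div_eq_one_iff_eq h0.ne', Finset.sum_const,
    Finset.card_univ, nsmul_eq_mul, mul_div_cancel₀ _ (by simp)]
  rcases le_total (∑ j, max (w j) 0) 1 with h | h
  · rw [max_eq_left (by linarith), max_eq_left h]; ring
  · rw [max_eq_right (by linarith), max_eq_right h]; ring

theorem simplexRetraction_eq_self {ι : Type*} [Fintype ι] {w : EuclideanSpace ℝ ι}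
    (h0 : ∀ i, 0 ≤ w i) (h1 : ∑ i, w i = 1) (i : ι) : simplexRetraction w i = w i := by
  simp [simplexRetraction, h0, h1]

/-- Weights of the Schauder projection onto the convex hull of the points `v i`. -/
def schauderWeight {ι X : Type*} [Fintype ι] [NormedAddCommGroup X] (v : ι → X) (ε : ℝ) (y : X)
    (i : ι) : ℝ :=
  max (ε - ‖y - v i‖) 0 / ∑ j, max (ε - ‖y - v j‖) 0

variable {X : Type*} [NormedAddCommGroup X] [NormedSpace ℝ X]

/-- Approximate fixed points for a continuous map of a convex set into a compact subset. -/
theorem Convex.exists_norm_sub_lt_of_mapsTo_isCompact {C K : Set X} (hC : Convex ℝ C)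
    (hK : IsCompact K) (hKC : K ⊆ C) (hne : C.Nonempty) {F : X → X} (hF : ContinuousOn F C)
    (hmaps : MapsTo F C K) {ε : ℝ} (hε : 0 < ε) : ∃ x ∈ C, ‖F x - x‖ < ε := by
  obtain ⟨t, htK, htfin, hcover⟩ := hK.finite_cover_balls hε
  have : Fintype t := htfin.fintype
  obtain ⟨x₀, hx₀⟩ := hne
  have hnear : ∀ y ∈ K, ∃ i : t, ‖y - i‖ < ε := by
    intro y hy
    obtain ⟨i, hi, hyi⟩ := mem_iUnion₂.mp (hcover hy)
    exact ⟨⟨i, hi⟩, by simpa [dist_eq_norm] using hyi⟩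
  have : Nonempty t := (hnear _ (hmaps hx₀)).nonempty
  have hden : ∀ y ∈ K, 0 < ∑ j : t, max (ε - ‖y - j‖) 0 := by
    intro y hy
    obtain ⟨i, hi⟩ := hnear y hy
    exact Finset.sum_pos' (fun _ _ => le_max_right _ _)
      ⟨i, Finset.mem_univ _, lt_max_of_lt_left (sub_pos.mpr hi)⟩
  set σ : EuclideanSpace ℝ t → X := fun w => ∑ i, simplexRetraction w i • (i : X)
  have hσ : Continuous σ := continuous_finsetSum _ fun i _ =>
    (continuous_simplexRetraction i).smul continuous_const
  have hσC : ∀ w, σ w ∈ C := fun w => hC.sum_mem (fun i _ => simplexRetraction_nonneg w i)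
    (sum_simplexRetraction w) fun i _ => hKC (htK i.2)
  have hFσ : Continuous fun w => F (σ w) := hF.comp_continuous hσ hσC
  have hFK : ∀ w, F (σ w) ∈ K := fun w => hmaps (hσC w)
  -- In barycentric coordinates, this is `F` followed by the Schauder projection. It takes values in
  -- the simplex, so its Brouwer fixed point lies there and is unchanged by the retraction.
  set W : EuclideanSpace ℝ t → EuclideanSpace ℝ t := fun w =>
    WithLp.toLp 2 fun i => schauderWeight ((↑) : t → X) ε (F (σ w)) i
  have hW0 : ∀ w i, 0 ≤ W w i := fun w i => by
    simp only [W, schauderWeight]; positivity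
  have hW1 : ∀ w, ∑ i, W w i = 1 := fun w => by
    simp only [W, schauderWeight]
    rw [← Finset.sum_div, div_self (hden _ (hFK w)).ne']
  have hWc : Continuous W := by
    refine (PiLp.continuous_toLp 2 _).comp (continuous_pi fun i => ?_)
    simp only [schauderWeight]
    have hnum : ∀ j : t, Continuous fun w => max (ε - ‖F (σ w) - j‖) 0 := fun j =>
      (continuous_const.sub (hFσ.sub continuous_const).norm).max continuous_const
    exact (hnum i).div (continuous_finsetSum _ fun j _ => hnum j) fun w => (hden _ (hFK w)).ne'
  have hWbdd : ∀ w, ‖W w‖ ≤ √(Fintype.card t) := by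
    intro w
    rw [EuclideanSpace.norm_eq]
    refine Real.sqrt_le_sqrt ?_
    calc ∑ i, ‖W w i‖ ^ 2 ≤ ∑ _i : t, (1 : ℝ) := by
          refine Finset.sum_le_sum fun i _ => ?_
          have h1 : W w i ≤ 1 := (hW1 w).symm ▸
            Finset.single_le_sum (fun j _ => hW0 w j) (Finset.mem_univ i)
          rw [Real.norm_of_nonneg (hW0 w i)]
          exact pow_le_one₀ (hW0 w i) h1
      _ = Fintype.card t := by simp
  obtain ⟨w, hw⟩ := hWc.exists_eq_self_of_norm_le hWbdd
  refine ⟨σ w, hσC w, ?_⟩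
  have hσw : σ w = ∑ i, W w i • (i : X) := by
    refine Finset.sum_congr rfl fun i _ => ?_
    have := simplexRetraction_eq_self (hW0 w) (hW1 w) i
    rw [← this, hw]
  -- Only net points within ε of F(σ w) carry weight, so their convex combination σ w also lies in
  -- that ball.
  have hpos : ∀ i, W w i ≠ 0 → (i : X) ∈ Metric.ball (F (σ w)) ε := by
    intro i hi
    by_contra hfar
    apply hi
    rw [mem_ball_iff_norm', not_lt] at hfar
    simp [W, schauderWeight, hfar]
  have hmem := (convex_ball (F (σ w)) ε).finsum_mem (hW0 w)
    ((finsum_eq_sum_of_fintype _).trans (hW1 w)) hpos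
  rw [finsum_eq_sum_of_fintype, ← hσw] at hmem
  rwa [mem_ball_iff_norm'] at hmem

/-- **Schauder's fixed point theorem** for a convex set that is mapped into a compact subset. -/
theorem Convex.exists_eq_self_of_mapsTo_isCompact {C K : Set X} (hC : Convex ℝ C)
    (hK : IsCompact K) (hKC : K ⊆ C) (hne : C.Nonempty) {F : X → X} (hF : ContinuousOn F C)
    (hmaps : MapsTo F C K) : ∃ x ∈ C, F x = x := by
  have happrox : ∀ n : ℕ, ∃ x ∈ C, ‖F x - x‖ < 1 / ((n : ℝ) + 1) := fun n =>
    hC.exists_norm_sub_lt_of_mapsTo_isCompact hK hKC hne hF hmaps (by positivity)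
  choose x hxC hx using happrox
  obtain ⟨y, hyK, φ, hφ, hlim⟩ := hK.tendsto_subseq fun n => hmaps (hxC n)
  have hdiff : Filter.Tendsto (fun n => F (x n) - x n) Filter.atTop (nhds 0) :=
    squeeze_zero_norm (fun n => (hx n).le) tendsto_one_div_add_atTop_nhds_zero_nat
  have hxlim : Filter.Tendsto (x ∘ φ) Filter.atTop (nhds y) := by
    simpa [Function.comp_def] using hlim.sub (hdiff.comp hφ.tendsto_atTop)
  have hxlim' : Filter.Tendsto (x ∘ φ) Filter.atTop (nhdsWithin y C) :=
    tendsto_nhdsWithin_iff.mpr ⟨hxlim, Filter.Eventually.of_forall fun n => hxC (φ n)⟩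
  exact ⟨y, hKC hyK, tendsto_nhds_unique ((hF y (hKC hyK)).tendsto.comp hxlim') hlim⟩

/-- A Birkhoff–Kellogg type theorem: a compact map on a sphere whose values stay in a half-space
`c ≤ φ` with `c > 0` has eigenvectors on the sphere, with eigenvalues of either sign. -/
theorem exists_mem_sphere_eq_smul_of_compact {ρ : ℝ} (hρ : 0 < ρ) {T : X → X}
    (hT : ContinuousOn T (Metric.sphere 0 ρ)) {K : Set X} (hK : IsCompact K)
    (hTK : MapsTo T (Metric.sphere 0 ρ) K) (φ : X →L[ℝ] ℝ) {c : ℝ} (hc : 0 < c)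
    (hφ : ∀ u ∈ Metric.sphere 0 ρ, c ≤ φ (T u)) (hφ0 : φ ≠ 0) {σ : ℝ} (hσ : |σ| = 1) :
    ∃ r > 0, ∃ u ∈ Metric.sphere 0 ρ, u = (σ * r) • T u := by
  set C : Set X := {v | c ≤ φ v}
  have hCclosed : IsClosed C := isClosed_le continuous_const φ.continuous
  have hCconv : Convex ℝ C := convex_halfSpace_ge φ.toLinearMap.isLinear c
  have hC0 : ∀ v ∈ C, 0 < ‖v‖ := by
    intro v hv
    refine norm_pos_iff.mpr fun h => ?_
    have : c ≤ φ v := hv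
    rw [h, map_zero] at this
    linarith
  set P : X → X := fun v => (σ * (ρ / ‖v‖)) • v
  have hP : ContinuousOn P C := by
    refine ContinuousOn.smul (continuousOn_const.mul ?_) continuousOn_id
    exact continuousOn_const.div continuous_norm.continuousOn fun v hv => (hC0 v hv).ne'
  have hPS : MapsTo P C (Metric.sphere 0 ρ) := by
    intro v hv
    have := hC0 v hv
    rw [mem_sphere_zero_iff_norm, norm_smul, norm_mul, Real.norm_eq_abs, hσ, one_mul,
      Real.norm_of_nonneg (by positivity)]
    field_simp
  obtain ⟨v₀, hv₀⟩ : C.Nonempty := by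
    obtain ⟨v, hv⟩ := DFunLike.ne_iff.mp hφ0
    have hv' : φ v ≠ 0 := hv
    exact ⟨(c / φ v) • v, by simp [C, hv']⟩
  obtain ⟨v, hv, hfix⟩ := hCconv.exists_eq_self_of_mapsTo_isCompact (F := T ∘ P) (K := K ∩ C)
    (hK.inter_right hCclosed) inter_subset_right ⟨v₀, hv₀⟩ (hT.comp hP hPS)
    (fun v hv => ⟨hTK (hPS hv), hφ _ (hPS hv)⟩)
  refine ⟨ρ / ‖v‖, div_pos hρ (hC0 v hv), P v, hPS hv, ?_⟩
  have hfix' : T (P v) = v := hfix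
  rw [hfix']

end Schauder

/-! ### Iterated primitives and the Green's function -/

/-- The operator `w ↦ ∫₀ᵗ w` on `C[0,1]`. -/
def primitive : C(Icc (0 : ℝ) 1, ℝ) →L[ℝ] C(Icc (0 : ℝ) 1, ℝ) :=
  LinearMap.mkContinuous
    { toFun := fun w => ⟨fun t => ∫ s in (0 : ℝ)..t, IccExtend zero_le_one w s,
        (intervalIntegral.continuous_primitive
          (fun a b => (w.continuous.Icc_extend' (h := zero_le_one)).intervalIntegrable a b) 0).comp
          continuous_subtype_val⟩
      map_add' := fun v w => by
        ext t
        exact intervalIntegral.integral_add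
          ((v.continuous.Icc_extend' (h := zero_le_one)).intervalIntegrable _ _)
          ((w.continuous.Icc_extend' (h := zero_le_one)).intervalIntegrable _ _)
      map_smul' := fun c w => by
        ext t
        exact intervalIntegral.integral_const_mul c _ }
    1 (fun w => by
      rw [ContinuousMap.norm_le _ (by positivity)]
      intro t
      refine (intervalIntegral.norm_integral_le_of_norm_le_const (C := ‖w‖)
        fun s _ => w.norm_coe_le_norm _).trans ?_
      rw [one_mul, sub_zero, abs_of_nonneg t.2.1]
      exact mul_le_of_le_one_right (norm_nonneg _) t.2.2)

theorem primitive_apply (w : C(Icc (0 : ℝ) 1, ℝ)) (t : Icc (0 : ℝ) 1) :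
    primitive w t = ∫ s in (0 : ℝ)..t, IccExtend zero_le_one w s := rfl

theorem continuous_IccExtend (w : C(Icc (0 : ℝ) 1, ℝ)) :
    Continuous (IccExtend (zero_le_one (α := ℝ)) w) := w.continuous.Icc_extend'

theorem hasDerivWithinAt_IccExtend_primitive (w : C(Icc (0 : ℝ) 1, ℝ)) {t : ℝ}
    (ht : t ∈ Icc (0 : ℝ) 1) :
    HasDerivWithinAt (IccExtend zero_le_one (primitive w)) (IccExtend zero_le_one w t)
      (Icc 0 1) t := by
  have h := ((continuous_IccExtend w).integral_hasStrictDerivAt 0 t).hasDerivAt.hasDerivWithinAt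
    (s := Icc (0 : ℝ) 1)
  refine h.congr_of_mem (fun s hs => ?_) ht
  rw [IccExtend_of_mem _ _ hs, primitive_apply]

/-- Antiderivatives vanishing at `0` are given by `primitive`. -/
theorem primitive_eq_of_hasDerivAt {w : C(Icc (0 : ℝ) 1, ℝ)} {G : ℝ → ℝ}
    (hG : ∀ t (ht : t ∈ Icc (0 : ℝ) 1), HasDerivAt G (w ⟨t, ht⟩) t) (h0 : G 0 = 0)
    (t : Icc (0 : ℝ) 1) : primitive w t = G t := by
  rw [primitive_apply, intervalIntegral.integral_eq_sub_of_hasDerivAt (f := G), h0, sub_zero]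
  · intro s hs
    rw [uIcc_of_le t.2.1] at hs
    have hs' : s ∈ Icc (0 : ℝ) 1 := ⟨hs.1, hs.2.trans t.2.2⟩
    rw [IccExtend_of_mem _ _ hs']
    exact hG s hs'
  · exact (continuous_IccExtend w).intervalIntegrable _ _

/-- Arzelà–Ascoli: both conditions are closed under pointwise limits, so the set is compact in the
product topology, and the common Lipschitz constant gives equicontinuity. -/
theorem isCompact_lipschitz_bounded (M : NNReal) :
    IsCompact {g : C(Icc (0 : ℝ) 1, ℝ) | (∀ t, g t ∈ Icc (-(M : ℝ)) M) ∧ LipschitzWith M g} := by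
  set S := {g : C(Icc (0 : ℝ) 1, ℝ) | (∀ t, g t ∈ Icc (-(M : ℝ)) M) ∧ LipschitzWith M g}
  refine ArzelaAscoli.isCompact_of_equicontinuous S ?_ ?_
  · have himage : ContinuousMap.toFun '' S =
        (univ.pi fun _ => Icc (-(M : ℝ)) M) ∩
          {g | ∀ s t, dist (g s) (g t) ≤ M * dist s t} := by
      ext g
      constructor
      · rintro ⟨h, hh, rfl⟩
        exact ⟨fun t _ => hh.1 t, hh.2.dist_le_mul⟩
      · rintro ⟨h1, h2⟩
        have hl : LipschitzWith M g := LipschitzWith.of_dist_le_mul h2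
        exact ⟨⟨g, hl.continuous⟩, ⟨fun t => h1 t (mem_univ t), hl⟩, rfl⟩
    rw [himage]
    refine (isCompact_univ_pi fun _ => isCompact_Icc).inter_right ?_
    have : {g : Icc (0 : ℝ) 1 → ℝ | ∀ s t, dist (g s) (g t) ≤ M * dist s t} =
        ⋂ s, ⋂ t, {g | dist (g s) (g t) ≤ M * dist s t} := by
      ext g; simp only [Set.mem_iInter]; rfl
    rw [this]
    exact isClosed_iInter fun s => isClosed_iInter fun t =>
      isClosed_le ((continuous_apply s).dist (continuous_apply t)) continuous_const
  · exact (LipschitzWith.uniformEquicontinuous _ M fun g => g.2.2).equicontinuous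

theorem primitive_mem_lipschitz_bounded {M : NNReal} {w : C(Icc (0 : ℝ) 1, ℝ)} (hw : ‖w‖ ≤ M) :
    primitive w ∈
      {g : C(Icc (0 : ℝ) 1, ℝ) | (∀ t, g t ∈ Icc (-(M : ℝ)) M) ∧ LipschitzWith M g} := by
  have hlip : LipschitzWith M (primitive w) := by
    refine LipschitzWith.of_dist_le_mul fun t s => ?_
    rw [dist_eq_norm, primitive_apply, primitive_apply,
      intervalIntegral.integral_interval_sub_left
        ((continuous_IccExtend w).intervalIntegrable _ _)
        ((continuous_IccExtend w).intervalIntegrable _ _)]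
    exact intervalIntegral.norm_integral_le_of_norm_le_const
      fun r _ => (w.norm_coe_le_norm _).trans hw
  refine ⟨fun t => abs_le.mp ?_, hlip⟩
  have h := hlip.dist_le_mul t ⟨0, by simp⟩
  have h0 : primitive w ⟨0, by simp⟩ = 0 := by simp [primitive_apply]
  rw [h0, dist_zero_right, Real.norm_eq_abs] at h
  refine h.trans (mul_le_of_le_one_right M.2 ?_)
  rw [Subtype.dist_eq, Real.dist_eq, sub_zero, abs_of_nonneg t.2.1]
  exact t.2.2

theorem primitive_const (c : ℝ) (t : Icc (0 : ℝ) 1) :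
    primitive (ContinuousMap.const _ c) t = c * t :=
  primitive_eq_of_hasDerivAt (G := fun t => c * t)
    (fun t _ => by simpa using (hasDerivAt_id t).const_mul c) (by simp) t

theorem primitive_primitive_const (c : ℝ) (t : Icc (0 : ℝ) 1) :
    primitive (primitive (ContinuousMap.const _ c)) t = c * t ^ 2 / 2 :=
  primitive_eq_of_hasDerivAt (G := fun t => c * t ^ 2 / 2)
    (fun t ht => by
      rw [primitive_const]
      have h := ((hasDerivAt_pow 2 t).const_mul c).div_const 2
      refine h.congr_deriv ?_
      simp
      ring) (by simp) t

theorem primitive_primitive (h : C(Icc (0 : ℝ) 1, ℝ)) (t : Icc (0 : ℝ) 1) :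
    primitive (primitive h) t = t * (∫ s in (0 : ℝ)..t, IccExtend zero_le_one h s) -
      ∫ s in (0 : ℝ)..t, s * IccExtend zero_le_one h s := by
  have hc := continuous_IccExtend h
  refine primitive_eq_of_hasDerivAt (G := fun t : ℝ =>
    t * (∫ s in (0 : ℝ)..t, IccExtend zero_le_one h s) -
      ∫ s in (0 : ℝ)..t, s * IccExtend zero_le_one h s) (fun t ht => ?_) (by simp) t
  have h0 := (hc.integral_hasStrictDerivAt 0 t).hasDerivAt
  have h1 := ((continuous_id.mul hc).integral_hasStrictDerivAt 0 t).hasDerivAt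
  refine (((hasDerivAt_id t).mul h0).sub h1).congr_deriv ?_
  simp [primitive_apply]

theorem primitive_primitive_primitive (h : C(Icc (0 : ℝ) 1, ℝ)) (t : Icc (0 : ℝ) 1) :
    primitive (primitive (primitive h)) t =
      ∫ s in (0 : ℝ)..t, (t - s) ^ 2 / 2 * IccExtend zero_le_one h s := by
  have hc := continuous_IccExtend h
  -- Expanding (t - s)² takes t out of the integrands, so the fundamental theorem of calculus
  -- applies term by term.
  have key := primitive_eq_of_hasDerivAt (w := primitive (primitive h)) (G := fun t : ℝ =>
    t ^ 2 / 2 * (∫ s in (0 : ℝ)..t, IccExtend zero_le_one h s) -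
      t * (∫ s in (0 : ℝ)..t, s * IccExtend zero_le_one h s) +
      ∫ s in (0 : ℝ)..t, s ^ 2 / 2 * IccExtend zero_le_one h s) (fun t ht => ?_) (by simp) t
  · rw [key, ← intervalIntegral.integral_const_mul, ← intervalIntegral.integral_const_mul,
      ← intervalIntegral.integral_sub, ← intervalIntegral.integral_add]
    · exact intervalIntegral.integral_congr fun s _ => by ring
    all_goals exact Continuous.intervalIntegrable (by fun_prop) _ _
  · have h0 := (hc.integral_hasStrictDerivAt 0 t).hasDerivAt
    have h1 := ((continuous_id.mul hc).integral_hasStrictDerivAt 0 t).hasDerivAt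
    have h2 := ((show Continuous fun s : ℝ => s ^ 2 / 2 * IccExtend zero_le_one h s by
      fun_prop).integral_hasStrictDerivAt 0 t).hasDerivAt
    refine (((((hasDerivAt_pow 2 t).div_const 2).mul h0).sub
      ((hasDerivAt_id t).mul h1)).add h2).congr_deriv ?_
    rw [primitive_primitive]
    simp
    ring

/-- Up to a quadratic polynomial in t, the kernel is minus the Cauchy kernel of threefold
integration. Its integral against h thus becomes explicit Cauchy data at 0 minus a triple primitive.
-/
theorem greenK_eq (t s : ℝ) : greenK t s =
    t ^ 2 / 2 * ((1 - s) ^ 2 * (2 * s + 1)) - t * (s * (1 - s) ^ 2) -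
      if s ≤ t then (t - s) ^ 2 / 2 else 0 := by
  unfold greenK
  split_ifs <;> ring

theorem integral_greenK_mul {h : ℝ → ℝ} (hc : Continuous h) {t : ℝ} (ht : t ∈ Icc (0 : ℝ) 1) :
    ∫ s in (0 : ℝ)..1, greenK t s * h s =
      t ^ 2 / 2 * (∫ s in (0 : ℝ)..1, (1 - s) ^ 2 * (2 * s + 1) * h s) -
        t * (∫ s in (0 : ℝ)..1, s * (1 - s) ^ 2 * h s) -
        ∫ s in (0 : ℝ)..t, (t - s) ^ 2 / 2 * h s := by
  set q : ℝ → ℝ := fun s => (t ^ 2 / 2 * ((1 - s) ^ 2 * (2 * s + 1)) - t * (s * (1 - s) ^ 2)) * h s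
  have hq : Continuous q := by fun_prop
  have hd : Continuous fun s => (t - s) ^ 2 / 2 * h s := by fun_prop
  have hleft : EqOn (fun s => greenK t s * h s) (fun s => q s - (t - s) ^ 2 / 2 * h s)
      (uIoc 0 t) := by
    intro s hs
    rw [uIoc_of_le ht.1] at hs
    simp only [q, greenK_eq, if_pos hs.2]
    ring
  have hright : EqOn (fun s => greenK t s * h s) q (uIoc t 1) := by
    intro s hs
    rw [uIoc_of_le ht.2] at hs
    simp only [q, greenK_eq, if_neg (not_le.mpr hs.1)]
    ring
  have hil : IntervalIntegrable (fun s => greenK t s * h s) MeasureTheory.volume 0 t :=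
    ((hq.sub hd).intervalIntegrable 0 t).congr hleft.symm
  have hir : IntervalIntegrable (fun s => greenK t s * h s) MeasureTheory.volume t 1 :=
    (hq.intervalIntegrable t 1).congr hright.symm
  rw [← intervalIntegral.integral_add_adjacent_intervals hil hir,
    intervalIntegral.integral_congr_ae (Filter.Eventually.of_forall hleft),
    intervalIntegral.integral_congr_ae (Filter.Eventually.of_forall hright),
    intervalIntegral.integral_sub (hq.intervalIntegrable _ _) (hd.intervalIntegrable _ _),
    sub_add_eq_add_sub, intervalIntegral.integral_add_adjacent_intervals
      (hq.intervalIntegrable _ _) (hq.intervalIntegrable _ _),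
    ← intervalIntegral.integral_const_mul, ← intervalIntegral.integral_const_mul,
    ← intervalIntegral.integral_sub]
  · congr 1
    refine intervalIntegral.integral_congr fun s _ => ?_
    simp only [q]
    ring
  all_goals exact Continuous.intervalIntegrable (by fun_prop) _ _

/-! ### Building C² functions, and the superposition operator -/

namespace C2

/-- Reduces continuity of maps into C²[0,1] to continuity of u, u' and u'' in the sup norm. -/
theorem isometry_jet : Isometry jet :=
  Isometry.of_dist_eq fun u v => by rw [dist_eq_norm, ← map_sub, dist_eq_norm]; rfl

theorem norm_derivMap_le {j : ℕ} (hj : j ≤ 2) (u : C2) : ‖derivMap j hj u‖ ≤ ‖u‖ := by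
  rw [norm_eq]
  interval_cases j
  · exact le_max_left _ _
  · exact (le_max_left _ _).trans (le_max_right _ _)
  · exact (le_max_right _ _).trans (le_max_right _ _)

theorem continuous_derivMap {j : ℕ} (hj : j ≤ 2) : Continuous (derivMap j hj) :=
  AddMonoidHomClass.continuous_of_bound (derivMap j hj) 1
    fun u => by simpa using norm_derivMap_le hj u

theorem D_zero (u : C2) : D 0 u = u.fn := iteratedDerivWithin_zero

variable {u₀ u₁ u₂ : C(Icc (0 : ℝ) 1, ℝ)}

theorem contDiffOn_IccExtend
    (h₁ : ∀ t ∈ Icc (0 : ℝ) 1, HasDerivWithinAt (IccExtend zero_le_one u₀)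
      (IccExtend zero_le_one u₁ t) (Icc 0 1) t)
    (h₂ : ∀ t ∈ Icc (0 : ℝ) 1, HasDerivWithinAt (IccExtend zero_le_one u₁)
      (IccExtend zero_le_one u₂ t) (Icc 0 1) t) :
    ContDiffOn ℝ 2 (IccExtend zero_le_one u₀) (Icc 0 1) := by
  have hU : UniqueDiffOn ℝ (Icc (0 : ℝ) 1) := uniqueDiffOn_Icc zero_lt_one
  have step : ∀ {v w : C(Icc (0 : ℝ) 1, ℝ)} {n : ℕ},
      (∀ t ∈ Icc (0 : ℝ) 1, HasDerivWithinAt (IccExtend zero_le_one v)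
        (IccExtend zero_le_one w t) (Icc 0 1) t) →
      ContDiffOn ℝ n (IccExtend zero_le_one w) (Icc 0 1) →
      ContDiffOn ℝ (n + 1) (IccExtend zero_le_one v) (Icc 0 1) := by
    intro v w n h hw
    refine (contDiffOn_succ_iff_derivWithin hU).mpr
      ⟨fun t ht => (h t ht).differentiableWithinAt, by simp, ?_⟩
    exact hw.congr fun t ht => (h t ht).derivWithin (hU t ht)
  exact_mod_cast step h₁ (step (n := 0) h₂
    (contDiffOn_zero.mpr (continuous_IccExtend u₂).continuousOn))

theorem jet_mk
    (h₁ : ∀ t ∈ Icc (0 : ℝ) 1, HasDerivWithinAt (IccExtend zero_le_one u₀)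
      (IccExtend zero_le_one u₁ t) (Icc 0 1) t)
    (h₂ : ∀ t ∈ Icc (0 : ℝ) 1, HasDerivWithinAt (IccExtend zero_le_one u₁)
      (IccExtend zero_le_one u₂ t) (Icc 0 1) t) :
    jet ⟨u₀, contDiffOn_IccExtend h₁ h₂⟩ = (u₀, u₁, u₂) := by
  have hU : UniqueDiffOn ℝ (Icc (0 : ℝ) 1) := uniqueDiffOn_Icc zero_lt_one
  set u : C2 := ⟨u₀, contDiffOn_IccExtend h₁ h₂⟩
  have hD1 : ∀ t ∈ Icc (0 : ℝ) 1, D 1 u t = IccExtend zero_le_one u₁ t := by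
    intro t ht
    rw [D, iteratedDerivWithin_one]
    exact (h₁ t ht).derivWithin (hU t ht)
  have hD2 : ∀ t ∈ Icc (0 : ℝ) 1, D 2 u t = IccExtend zero_le_one u₂ t := by
    intro t ht
    rw [D, iteratedDerivWithin_succ]
    refine (derivWithin_congr hD1 (hD1 t ht)).trans ?_
    exact (h₂ t ht).derivWithin (hU t ht)
  refine Prod.ext (derivMap_zero u) (Prod.ext ?_ ?_)
  · ext t
    exact (hD1 t t.2).trans (IccExtend_val _ _ t)
  · ext t
    exact (hD2 t t.2).trans (IccExtend_val _ _ t)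

theorem hasDerivWithinAt_IccExtend_const_add_primitive (a : ℝ) (w : C(Icc (0 : ℝ) 1, ℝ)) {t : ℝ}
    (ht : t ∈ Icc (0 : ℝ) 1) :
    HasDerivWithinAt (IccExtend zero_le_one (ContinuousMap.const (Icc (0 : ℝ) 1) a + primitive w))
      (IccExtend zero_le_one w t) (Icc 0 1) t :=
  (hasDerivWithinAt_IccExtend_primitive w ht).const_add a

/-- The function with value `a` and slope `b` at `0` and with second derivative `w`. -/
def ofCauchyData (a b : ℝ) (w : C(Icc (0 : ℝ) 1, ℝ)) : C2 :=
  ⟨ContinuousMap.const _ a + primitive (ContinuousMap.const _ b + primitive w),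
    contDiffOn_IccExtend
      (fun _ ht => hasDerivWithinAt_IccExtend_const_add_primitive a _ ht)
      (fun _ ht => hasDerivWithinAt_IccExtend_const_add_primitive b w ht)⟩

theorem jet_ofCauchyData (a b : ℝ) (w : C(Icc (0 : ℝ) 1, ℝ)) :
    jet (ofCauchyData a b w) =
      (ContinuousMap.const _ a + primitive (ContinuousMap.const _ b + primitive w),
        ContinuousMap.const _ b + primitive w, w) :=
  jet_mk (fun _ ht => hasDerivWithinAt_IccExtend_const_add_primitive a _ ht)
    (fun _ ht => hasDerivWithinAt_IccExtend_const_add_primitive b w ht)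

theorem derivMap_two_ofCauchyData (a b : ℝ) (w : C(Icc (0 : ℝ) 1, ℝ)) :
    derivMap 2 le_rfl (ofCauchyData a b w) = w :=
  congrArg (fun p => p.2.2) (jet_ofCauchyData a b w)

theorem continuous_const_map : Continuous fun a : ℝ => ContinuousMap.const (Icc (0 : ℝ) 1) a :=
  ContinuousMap.continuous_const'

theorem continuous_ofCauchyData :
    Continuous fun p : ℝ × ℝ × C(Icc (0 : ℝ) 1, ℝ) => ofCauchyData p.1 p.2.1 p.2.2 := by
  rw [isometry_jet.isEmbedding.continuous_iff]
  have : (jet ∘ fun p : ℝ × ℝ × C(Icc (0 : ℝ) 1, ℝ) => ofCauchyData p.1 p.2.1 p.2.2) =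
      fun p => (ContinuousMap.const _ p.1 +
        primitive (ContinuousMap.const _ p.2.1 + primitive p.2.2),
        ContinuousMap.const _ p.2.1 + primitive p.2.2, p.2.2) :=
    funext fun p => jet_ofCauchyData _ _ _
  rw [this]
  have h1 : Continuous fun p : ℝ × ℝ × C(Icc (0 : ℝ) 1, ℝ) =>
      ContinuousMap.const (Icc (0 : ℝ) 1) p.2.1 + primitive p.2.2 :=
    (continuous_const_map.comp (by fun_prop)).add (primitive.continuous.comp (by fun_prop))
  exact ((continuous_const_map.comp continuous_fst).add (primitive.continuous.comp h1)).prodMk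
    (h1.prodMk (by fun_prop))

/-- The superposition operator of a continuous `f` on the closed `ρ`-ball, extended to `C²[0,1]` as
a bounded continuous operator. -/
theorem exists_superposition {ρ : ℝ} (hρ : 0 < ρ) {f : ℝ → ℝ → ℝ → ℝ → ℝ}
    (hf : ContinuousOn (fun p : ℝ × ℝ × ℝ × ℝ => f p.1 p.2.1 p.2.2.1 p.2.2.2)
      (Icc 0 1 ×ˢ Icc (-ρ) ρ ×ˢ Icc (-ρ) ρ ×ˢ Icc (-ρ) ρ)) :
    ∃ N : C2 → C(Icc (0 : ℝ) 1, ℝ), Continuous N ∧ (∃ M : NNReal, ∀ u, ‖N u‖ ≤ M) ∧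
      ∀ u ∈ Metric.closedBall (0 : C2) ρ, ∀ t ∈ Icc (0 : ℝ) 1,
        (u.fn t ∈ Icc (-ρ) ρ ∧ D 1 u t ∈ Icc (-ρ) ρ ∧ D 2 u t ∈ Icc (-ρ) ρ) ∧
        IccExtend zero_le_one (N u) t = f t (u.fn t) (D 1 u t) (D 2 u t) := by
  have hle : -ρ ≤ ρ := by linarith
  obtain ⟨M, hM⟩ := (isCompact_Icc.prod (isCompact_Icc.prod
    (isCompact_Icc.prod isCompact_Icc))).exists_bound_of_continuousOn hf
  -- Clamping the last three arguments to [-ρ, ρ] makes the operator globally defined, bounded and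
  -- continuous without changing it on the ball.
  set cl : Icc (0 : ℝ) 1 × ℝ × ℝ × ℝ → ℝ × ℝ × ℝ × ℝ := fun p =>
    (p.1, projIcc (-ρ) ρ hle p.2.1, projIcc (-ρ) ρ hle p.2.2.1, projIcc (-ρ) ρ hle p.2.2.2)
  have hcl : Continuous cl := by
    have h := continuous_subtype_val.comp (continuous_projIcc (h := hle))
    exact (continuous_subtype_val.comp continuous_fst).prodMk ((h.comp (by fun_prop)).prodMk
      ((h.comp (by fun_prop)).prodMk (h.comp (by fun_prop))))
  have hclmem : ∀ p, cl p ∈ Icc (0 : ℝ) 1 ×ˢ Icc (-ρ) ρ ×ˢ Icc (-ρ) ρ ×ˢ Icc (-ρ) ρ := fun p =>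
    ⟨p.1.2, (projIcc _ _ hle _).2, (projIcc _ _ hle _).2, (projIcc _ _ hle _).2⟩
  let F : C(Icc (0 : ℝ) 1 × ℝ × ℝ × ℝ, ℝ) := ⟨_, hf.comp_continuous hcl hclmem⟩
  refine ⟨fun u => F.comp ((ContinuousMap.id _).prodMk ((derivMap 0 (by norm_num) u).prodMk
    ((derivMap 1 (by norm_num) u).prodMk (derivMap 2 le_rfl u)))), ?_, ⟨M.toNNReal, ?_⟩, ?_⟩
  · refine ContinuousMap.continuous_of_continuous_uncurry _ (F.continuous.comp ?_)
    have h : ∀ {j : ℕ} (hj : j ≤ 2),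
        Continuous fun p : C2 × Icc (0 : ℝ) 1 => derivMap j hj p.1 p.2 := fun hj =>
      ((continuous_derivMap hj).comp continuous_fst).eval continuous_snd
    exact continuous_snd.prodMk ((h _).prodMk ((h _).prodMk (h _)))
  · intro u
    rw [ContinuousMap.norm_le _ (NNReal.coe_nonneg _)]
    exact fun t => (hM _ (hclmem _)).trans (Real.le_coe_toNNReal M)
  · intro u hu t ht
    have hmem : ∀ j, j ≤ 2 → D j u t ∈ Icc (-ρ) ρ := by
      intro j hj
      refine abs_le.mp ?_
      calc |D j u t| = ‖derivMap j hj u ⟨t, ht⟩‖ := rfl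
        _ ≤ ‖derivMap j hj u‖ := ContinuousMap.norm_coe_le_norm _ _
        _ ≤ ‖u‖ := norm_derivMap_le hj u
        _ ≤ ρ := by simpa using hu
    have h0 : u.fn t ∈ Icc (-ρ) ρ := by rw [← D_zero]; exact hmem 0 (by norm_num)
    refine ⟨⟨h0, hmem 1 (by norm_num), hmem 2 le_rfl⟩, ?_⟩
    rw [IccExtend_of_mem _ _ ht]
    change f t (projIcc (-ρ) ρ hle (D 0 u t)) (projIcc (-ρ) ρ hle (D 1 u t))
      (projIcc (-ρ) ρ hle (D 2 u t)) = _
    rw [D_zero, projIcc_of_mem hle h0, projIcc_of_mem hle (hmem 1 (by norm_num)),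
      projIcc_of_mem hle (hmem 2 le_rfl)]

end C2

/-! ### The Hammerstein operator -/

/-- The functional `h ↦ ∫₀¹ a h` on `C[0,1]`. -/
def integralMul (a : C(Icc (0 : ℝ) 1, ℝ)) : C(Icc (0 : ℝ) 1, ℝ) →L[ℝ] ℝ :=
  (ContinuousMap.evalCLM ℝ 1).comp (primitive.comp (ContinuousLinearMap.mul ℝ _ a))

theorem integralMul_restrict {a : ℝ → ℝ} (ha : Continuous a) (h : C(Icc (0 : ℝ) 1, ℝ)) :
    integralMul ⟨fun t => a t, ha.comp continuous_subtype_val⟩ h =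
      ∫ s in (0 : ℝ)..1, a s * IccExtend zero_le_one h s := by
  change ∫ s in (0 : ℝ)..1, IccExtend zero_le_one (_ * h : C(Icc (0 : ℝ) 1, ℝ)) s = _
  refine intervalIntegral.integral_congr fun s hs => ?_
  rw [uIcc_of_le zero_le_one] at hs
  simp only [IccExtend_of_mem _ _ hs]
  rfl

namespace C2

theorem fn_ofCauchyData (a b c : ℝ) (h : C(Icc (0 : ℝ) 1, ℝ)) {t : ℝ} (ht : t ∈ Icc (0 : ℝ) 1) :
    (ofCauchyData a b (ContinuousMap.const _ c - primitive h)).fn t =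
      a + b * t + c * t ^ 2 / 2 -
        ∫ s in (0 : ℝ)..t, (t - s) ^ 2 / 2 * IccExtend zero_le_one h s := by
  rw [fn, IccExtend_of_mem _ _ ht]
  change a + primitive (ContinuousMap.const _ b +
    primitive (ContinuousMap.const _ c - primitive h)) ⟨t, ht⟩ = _
  rw [map_sub, map_add, map_sub, ContinuousMap.add_apply, ContinuousMap.sub_apply,
    primitive_const, primitive_primitive_const, primitive_primitive_primitive]
  ring

/-- The perturbed Hammerstein operator as a compact operator on the sphere of radius `ρ`, with the
values of the second derivatives at the endpoints. -/
theorem exists_hammerstein_operator {ρ : ℝ} (hρ : 0 < ρ) {f : ℝ → ℝ → ℝ → ℝ → ℝ}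
    (hf : ContinuousOn (fun p : ℝ × ℝ × ℝ × ℝ => f p.1 p.2.1 p.2.2.1 p.2.2.2)
      (Icc 0 1 ×ˢ Icc (-ρ) ρ ×ˢ Icc (-ρ) ρ ×ˢ Icc (-ρ) ρ))
    {H₁ H₂ : C2 → ℝ} (hH₁ : ContinuousOn H₁ (Metric.sphere 0 ρ))
    (hH₂ : ContinuousOn H₂ (Metric.sphere 0 ρ)) {M₁ M₂ : ℝ}
    (hM₁ : ∀ u ∈ Metric.sphere (0 : C2) ρ, |H₁ u| ≤ M₁)
    (hM₂ : ∀ u ∈ Metric.sphere (0 : C2) ρ, |H₂ u| ≤ M₂) :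
    ∃ (T : C2 → C2) (K : Set C2) (N : C2 → C(Icc (0 : ℝ) 1, ℝ)),
      ContinuousOn T (Metric.sphere 0 ρ) ∧ IsCompact K ∧ MapsTo T (Metric.sphere 0 ρ) K ∧
      ∀ u ∈ Metric.sphere (0 : C2) ρ,
        (∀ t ∈ Icc (0 : ℝ) 1,
          (u.fn t ∈ Icc (-ρ) ρ ∧ D 1 u t ∈ Icc (-ρ) ρ ∧ D 2 u t ∈ Icc (-ρ) ρ) ∧
          IccExtend zero_le_one (N u) t = f t (u.fn t) (D 1 u t) (D 2 u t)) ∧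
        (∀ t ∈ Icc (0 : ℝ) 1, (T u).fn t = gamma1 t * H₁ u + gamma2 t * H₂ u +
          ∫ s in (0 : ℝ)..1, greenK t s * IccExtend zero_le_one (N u) s) ∧
        derivMap 2 le_rfl (T u) 0 = 6 * (H₁ u + H₂ u) +
          ∫ s in (0 : ℝ)..1, (1 - s) ^ 2 * (2 * s + 1) * IccExtend zero_le_one (N u) s ∧
        derivMap 2 le_rfl (T u) 1 = 6 * (H₁ u + H₂ u) -
          ∫ s in (0 : ℝ)..1, s ^ 2 * (3 - 2 * s) * IccExtend zero_le_one (N u) s := by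
  obtain ⟨N, hN, ⟨M, hM⟩, hNf⟩ := exists_superposition hρ hf
  have ha : Continuous fun s : ℝ => (1 - s) ^ 2 * (2 * s + 1) := by fun_prop
  have hb : Continuous fun s : ℝ => s * (1 - s) ^ 2 := by fun_prop
  set A := integralMul ⟨fun t => (1 - t : ℝ) ^ 2 * (2 * t + 1), ha.comp continuous_subtype_val⟩
  set B := integralMul ⟨fun t => (t : ℝ) * (1 - t) ^ 2, hb.comp continuous_subtype_val⟩
  have hA : ∀ h, A h = _ := integralMul_restrict ha
  have hB : ∀ h, B h = _ := integralMul_restrict hb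
  set Ψ : ℝ × ℝ × ℝ × C(Icc (0 : ℝ) 1, ℝ) → C2 := fun p =>
    ofCauchyData p.1 p.2.1 (ContinuousMap.const _ p.2.2.1 - p.2.2.2)
  have hΨ : Continuous Ψ := by
    refine continuous_ofCauchyData.comp (continuous_fst.prodMk
      (continuous_snd.fst.prodMk ?_))
    exact (continuous_const_map.comp continuous_snd.snd.fst).sub continuous_snd.snd.snd
  -- The Cauchy data of T u at 0: γ₁ and γ₂ have values 1, 0, slopes -4, -2 and second derivatives
  -- 6, 6 there, while `B` and `A` come from the linear and quadratic terms of the kernel. The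
  -- second derivative of T u is the constant third entry minus the last.
  set p : C2 → ℝ × ℝ × ℝ × C(Icc (0 : ℝ) 1, ℝ) := fun u =>
    (H₁ u, -4 * H₁ u - 2 * H₂ u - B (N u), 6 * (H₁ u + H₂ u) + A (N u), primitive (N u))
  have hp : ContinuousOn p (Metric.sphere 0 ρ) := by
    have hNc : ContinuousOn N (Metric.sphere 0 ρ) := hN.continuousOn
    exact hH₁.prodMk ((((continuousOn_const.mul hH₁).sub (continuousOn_const.mul hH₂)).sub
      (B.continuous.comp_continuousOn hNc)).prodMk
      (((continuousOn_const.mul (hH₁.add hH₂)).add (A.continuous.comp_continuousOn hNc)).prodMk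
      (primitive.continuous.comp_continuousOn hNc)))
  have hbound : ∀ (L : C(Icc (0 : ℝ) 1, ℝ) →L[ℝ] ℝ) u, |L (N u)| ≤ ‖L‖ * M := fun L u =>
    (L.le_opNorm (N u)).trans (by gcongr; exact hM u)
  set S := {g : C(Icc (0 : ℝ) 1, ℝ) | (∀ t, g t ∈ Icc (-(M : ℝ)) M) ∧ LipschitzWith M g}
  set b := 4 * M₁ + 2 * M₂ + ‖B‖ * M
  set c := 6 * (M₁ + M₂) + ‖A‖ * M
  refine ⟨Ψ ∘ p, Ψ '' (Icc (-M₁) M₁ ×ˢ Icc (-b) b ×ˢ Icc (-c) c ×ˢ S), N,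
    hΨ.comp_continuousOn hp, ?_, ?_, ?_⟩
  · exact (isCompact_Icc.prod (isCompact_Icc.prod (isCompact_Icc.prod
      (isCompact_lipschitz_bounded M)))).image hΨ
  · intro u hu
    have h1 := abs_le.mp (hM₁ u hu)
    have h2 := abs_le.mp (hM₂ u hu)
    have hAu := abs_le.mp (hbound A u)
    have hBu := abs_le.mp (hbound B u)
    refine mem_image_of_mem Ψ ⟨h1, ⟨?_, ?_⟩, ⟨?_, ?_⟩, primitive_mem_lipschitz_bounded (hM u)⟩ <;>
      simp only [p, b, c] <;> linarith [h1.1, h1.2, h2.1, h2.2, hAu.1, hAu.2, hBu.1, hBu.2]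
  · intro u hu
    have hc : Continuous (IccExtend zero_le_one (N u)) := continuous_IccExtend (N u)
    have hd2 : derivMap 2 le_rfl ((Ψ ∘ p) u) =
        ContinuousMap.const _ (6 * (H₁ u + H₂ u) + A (N u)) - primitive (N u) :=
      derivMap_two_ofCauchyData _ _ _
    refine ⟨hNf u (Metric.sphere_subset_closedBall hu), fun t ht => ?_, ?_, ?_⟩
    · rw [integral_greenK_mul hc ht, ← hA, ← hB]
      refine (fn_ofCauchyData _ _ _ _ ht).trans ?_
      simp only [gamma1, gamma2]
      ring
    · rw [hd2, ← hA, ContinuousMap.sub_apply, primitive_apply]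
      simp
    -- At t = 1 the primitive contributes -∫ h, and (1-s)² (2s+1) - 1 = -s² (3-2s).
    · rw [hd2, ContinuousMap.sub_apply, primitive_apply, ContinuousMap.const_apply, hA,
        add_sub_assoc, sub_eq_add_neg (6 * (H₁ u + H₂ u)), ← intervalIntegral.integral_neg,
        Icc.coe_one, ← intervalIntegral.integral_sub]
      · congr 1
        exact intervalIntegral.integral_congr fun s _ => by ring
      all_goals exact Continuous.intervalIntegrable (by fun_prop) _ _

/-- Evaluation of the second derivative at `t`. -/
def evalDerivTwo (t : Icc (0 : ℝ) 1) : C2 →L[ℝ] ℝ :=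
  (ContinuousMap.evalCLM ℝ t).comp ⟨derivMap 2 le_rfl, continuous_derivMap le_rfl⟩

theorem evalDerivTwo_ne_zero (t : Icc (0 : ℝ) 1) : evalDerivTwo t ≠ 0 := by
  refine DFunLike.ne_iff.mpr ⟨ofCauchyData 0 0 (ContinuousMap.const _ 1), ?_⟩
  change derivMap 2 le_rfl (ofCauchyData 0 0 (ContinuousMap.const _ 1)) t ≠ 0
  rw [derivMap_two_ofCauchyData]
  simp

end C2

end

/-! ### Eigenvalues of both signs for the boundary value problem -/

theorem mainTheorem1 (ρ : ℝ) (hρ : 0 < ρ)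
    (f : ℝ → ℝ → ℝ → ℝ → ℝ)
    (hf : ContinuousOn (fun p : ℝ × ℝ × ℝ × ℝ => f p.1 p.2.1 p.2.2.1 p.2.2.2)
      (Icc 0 1 ×ˢ Icc (-ρ) ρ ×ˢ Icc (-ρ) ρ ×ˢ Icc (-ρ) ρ))
    (δ : ℝ → ℝ) (hδ : ContinuousOn δ (Icc 0 1)) (hδ_nonneg : ∀ t ∈ Icc (0 : ℝ) 1, 0 ≤ δ t)
    (H₁ H₂ : C2 → ℝ)
    (hH₁ : ContinuousOn H₁ (Metric.closedBall 0 ρ))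
    (hH₂ : ContinuousOn H₂ (Metric.closedBall 0 ρ))
    (hH₁_bdd : ∃ M, ∀ u ∈ Metric.closedBall (0 : C2) ρ, |H₁ u| ≤ M)
    (hH₂_bdd : ∃ M, ∀ u ∈ Metric.closedBall (0 : C2) ρ, |H₂ u| ≤ M)
    (η₁ η₂ : ℝ)
    (hη₁ : ∀ u ∈ Metric.sphere (0 : C2) ρ, η₁ ≤ H₁ u)
    (hη₂ : ∀ u ∈ Metric.sphere (0 : C2) ρ, η₂ ≤ H₂ u)
    (h : ((∀ t ∈ Icc (0 : ℝ) 1, ∀ x ∈ Icc (-ρ) ρ, ∀ y ∈ Icc (-ρ) ρ, ∀ z ∈ Icc (-ρ) ρ,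
            δ t ≤ f t x y z) ∧
          0 < 6 * (η₁ + η₂) + ∫ s in (0 : ℝ)..1, (1 - s) ^ 2 * (2 * s + 1) * δ s) ∨
        ((∀ t ∈ Icc (0 : ℝ) 1, ∀ x ∈ Icc (-ρ) ρ, ∀ y ∈ Icc (-ρ) ρ, ∀ z ∈ Icc (-ρ) ρ,
            δ t ≤ -f t x y z) ∧
          0 < 6 * (η₁ + η₂) + ∫ s in (0 : ℝ)..1, s ^ 2 * (3 - 2 * s) * δ s)) :
    (∃ lam : ℝ, 0 < lam ∧ ∃ u ∈ Metric.sphere (0 : C2) ρ, IsEigenpair f H₁ H₂ lam u) ∧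
    (∃ lam : ℝ, lam < 0 ∧ ∃ u ∈ Metric.sphere (0 : C2) ρ, IsEigenpair f H₁ H₂ lam u) := by
  obtain ⟨M₁, hM₁⟩ := hH₁_bdd
  obtain ⟨M₂, hM₂⟩ := hH₂_bdd
  have hsub : Metric.sphere (0 : C2) ρ ⊆ Metric.closedBall 0 ρ := Metric.sphere_subset_closedBall
  obtain ⟨T, K, N, hT, hK, hTK, hTu⟩ := C2.exists_hammerstein_operator hρ hf (hH₁.mono hsub)
    (hH₂.mono hsub) (fun u hu => hM₁ u (hsub hu)) (fun u hu => hM₂ u (hsub hu))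
  have hδi : ∀ a : ℝ → ℝ, Continuous a →
      IntervalIntegrable (fun s => a s * δ s) MeasureTheory.volume 0 1 := fun a ha =>
    ContinuousOn.intervalIntegrable_of_Icc zero_le_one (ha.continuousOn.mul hδ)
  have hNi : ∀ (a : ℝ → ℝ) (u : C2), Continuous a → IntervalIntegrable
      (fun s => a s * IccExtend zero_le_one (N u) s) MeasureTheory.volume 0 1 := fun a u ha =>
    (ha.mul (continuous_IccExtend (N u))).intervalIntegrable _ _
  -- The second derivative is evaluated at 0 under (a) and at 1 under (b); c is the quantity assumed
  -- positive. The weights are nonnegative on [0,1], so the bound on f can be integrated.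
  obtain ⟨t₀, c, hc, hφ⟩ : ∃ (t₀ : Icc (0 : ℝ) 1) (c : ℝ), 0 < c ∧
      ∀ u ∈ Metric.sphere (0 : C2) ρ, c ≤ C2.evalDerivTwo t₀ (T u) := by
    rcases h with ⟨hle, hpos⟩ | ⟨hle, hpos⟩
    · refine ⟨0, _, hpos, fun u hu => ?_⟩
      obtain ⟨hNf, -, h0, -⟩ := hTu u hu
      refine le_of_le_of_eq ?_ h0.symm
      have hint := intervalIntegral.integral_mono_on zero_le_one
        (hδi (fun s => (1 - s) ^ 2 * (2 * s + 1)) (by fun_prop))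
        (hNi (fun s => (1 - s) ^ 2 * (2 * s + 1)) u (by fun_prop)) (fun s hs => by
          obtain ⟨⟨hx, hy, hz⟩, hfs⟩ := hNf s hs
          have hw : 0 ≤ (1 - s) ^ 2 * (2 * s + 1) :=
            mul_nonneg (sq_nonneg _) (by linarith [hs.1])
          exact mul_le_mul_of_nonneg_left (hfs ▸ hle s hs _ hx _ hy _ hz) hw)
      linarith [hη₁ u hu, hη₂ u hu]
    · refine ⟨1, _, hpos, fun u hu => ?_⟩
      obtain ⟨hNf, -, -, h1⟩ := hTu u hu
      refine le_of_le_of_eq ?_ h1.symm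
      have hint := intervalIntegral.integral_mono_on zero_le_one
        (hδi (fun s => s ^ 2 * (3 - 2 * s)) (by fun_prop))
        (hNi (fun s => s ^ 2 * (3 - 2 * s)) u (by fun_prop)).neg (fun s hs => by
          obtain ⟨⟨hx, hy, hz⟩, hfs⟩ := hNf s hs
          have hw : 0 ≤ s ^ 2 * (3 - 2 * s) :=
            mul_nonneg (sq_nonneg _) (by linarith [hs.2])
          refine (mul_le_mul_of_nonneg_left (hle s hs _ hx _ hy _ hz) hw).trans_eq ?_
          simp only [Pi.neg_apply]
          rw [hfs, mul_neg])
      simp only [Pi.neg_apply, intervalIntegral.integral_neg] at hint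
      linarith [hη₁ u hu, hη₂ u hu]
  have hpair : ∀ (lam : ℝ), ∀ u ∈ Metric.sphere (0 : C2) ρ, u = lam • T u →
      IsEigenpair f H₁ H₂ lam u := by
    intro lam u hu hlam
    obtain ⟨hNf, hfn, -⟩ := hTu u hu
    refine ⟨by rw [mem_sphere_zero_iff_norm.mp hu]; exact hρ, fun t ht => ?_⟩
    have h1 : u.fn t = lam * (T u).fn t := by
      have := C2.D_smul (j := 0) (by norm_num) lam (T u) ht
      rwa [← hlam, C2.D_zero, C2.D_zero] at this
    rw [h1, hfn t ht]
    congr 2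
    refine intervalIntegral.integral_congr fun s hs => ?_
    rw [uIcc_of_le zero_le_one] at hs
    simp only [(hNf s hs).2]
  have key : ∀ σ : ℝ, |σ| = 1 → ∃ r > 0, ∃ u ∈ Metric.sphere (0 : C2) ρ, u = (σ * r) • T u :=
    fun σ hσ => exists_mem_sphere_eq_smul_of_compact hρ hT hK hTK (C2.evalDerivTwo t₀) hc hφ
      (C2.evalDerivTwo_ne_zero t₀) hσ
  constructor
  · obtain ⟨r, hr, u, hu, hur⟩ := key 1 (by simp)
    exact ⟨1 * r, by linarith, u, hu, hpair _ u hu hur⟩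
  · obtain ⟨r, hr, u, hu, hur⟩ := key (-1) (by simp)
    exact ⟨-1 * r, by linarith, u, hu, hpair _ u hu hur⟩
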